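/- Let $A\in\mathbb R^{m\times n}$, $b\in\mathbb R^m$, let $f:\mathbb R^n\to\mathbb R$ be $\alpha$-strongly convex for some $\alpha>0$, and let $\hat x$ be the (unique) solution of $\min f(x)$ subject to $Ax=b$, which is assumed to be feasible. Write $\partial f$ for the subdifferential, $f^*(y)=\sup_x\langle y,x\rangle-f(x)$ for the conjugate, $\mathcal R(A^T)$ for the range of $A^T$, $\|\cdot\|$ for the Euclidean norm, $B_1$ for its closed unit ball, and $D_f^{x^*}(x,y)=f(y)-f(x)-\langle x^*,y-x\rangle$ for the Bregman distance with respect to $x^*\in\partial f(x)$. The Bregman projection of $x$ onto a nonempty closed convex set $C$ with respect to $x^*$ is the unique minimizer $\Pi_C^{x^*}(x)$ of $y\mapsto D_f^{x^*}(x,y)$ over $C$; a vector $z^*\in\partial f(z)$ is called an admissible subgradient for $z=\Pi_C^{x^*}(x)$ if $\langle z^*-x^*,y-z\rangle\ge 0$ for all $y\in C$. Assume that * $\partial f$ is calm at $\hat x$: $\partial f(\hat x)\neq\emptyset$ and there are $\varepsilon,L>0$ with $\partial f(x)\subset\partial f(\hat x)+L\|x-\hat x\|B_1$ whenever $\|x-\hat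 x\|\le\varepsilon$; * $\{\partial f(\hat x),\mathcal R(A^T)\}$ is linearly regular: the two sets intersect and there is $\gamma>0$ with $\operatorname{dist}(y,\partial f(\hat x)\cap\mathcal R(A^T))^2\le\gamma\big(\operatorname{dist}(y,\partial f(\hat x))^2+\operatorname{dist}(y,\mathcal R(A^T))^2\big)$ for all $y\in\mathbb R^n$. Let $I_1,\dots,I_r$ be a (not necessarily disjoint) covering of $\{1,\dots,m\}$, let $A_i$ and $b_i$ consist of the rows of $A$ and the entries of $b$ indexed by $I_i$, let $\{1,\dots,r\}=I_C\,\dot\cup\,I_Q$ be an arbitrary partition of the indices into two types, and let $p_1,\dots,p_r>0$ with $\sum_i p_i=1$. Let $x_0^*\in\mathcal R(A^T)$ and $x_0=\nabla f^*(x_0^*)$. Consider the following randomized method. In step $k$ draw $i_k=i$ with probability $p_i$, independently of everything determined before step $k$ (in particular of $i_0,\dots,i_{k-1}$ and of $x_0,x_0^*,\dots,x_k,x_k^*$). * If $i\in I_C$, let $x_{k+1}=\Pi_C^{x_k^*}(x_k)$ with $C=\{x: A_ix=b_i\}$, and let $x_{k+1}^*$ be any admissible subgradient for it. * If $i\in I_Q$,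 put $w_k=A_ix_k-b_i$, $u_k=A_i^Tw_k$, $\beta_k=\langle u_k,x_k\rangle-\|w_k\|^2$, let $x_{k+1}=\Pi_H^{x_k^*}(x_k)$ with $H=\{x:\langle u_k,x\rangle\le\beta_k\}$, and let $x_{k+1}^*=x_k^*-t_ku_k\in\partial f(x_{k+1})$, where $t_k$ minimizes $t\mapsto f^*(x_k^*-tu_k)+t\beta_k$ over $\mathbb R$. Where $x_{k+1}^*$ is not unique it may be chosen in any measurable, nonanticipating (possibly random) way. Then there are constants $q\in(0,1)$ and $c>0$, which depend only on $f$, $A$, $b$, the covering, the partition $(I_C,I_Q)$, the probabilities $p_i$ and $x_0^*$, such that for every such run of the method all the expectations below are finite, the iterates converge in expectation to $\hat x$, i.e. $\mathbb E\,\|x_k-\hat x\|\to 0$, and for all $k\ge 0$ $$\mathbb E\big[D_f^{x_{k+1}^*}(x_{k+1},\hat x)\big]\le q\cdot\mathbb E\big[D_f^{x_k^*}(x_k,\hat x)\big]\qquad\text{and}\qquad \mathbb E\,\|x_k-\hat x\|\le c\,q^{k/2}.$$ -/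

import Mathlib

open MeasureTheory ProbabilityTheory Filter Topology
open scoped RealInnerProductSpace Pointwise Gradient

namespace BregmanSFP

section Convex

variable {E : Type*} [NormedAddCommGroup E] [InnerProductSpace ℝ E]

/-- The convex subdifferential `∂f(x)`. -/
def subdiff (f : E → ℝ) (x : E) : Set E :=
  {xs | ∀ y, f x + ⟪xs, y - x⟫ ≤ f y}

/-- The convex conjugate `f*(x*) = sup_x ⟪x*, x⟫ - f x`. For a strongly convex `f` the
supremum is over a nonempty set of reals that is bounded above. -/
noncomputable def conjugate (f : E → ℝ) (xs : E) : ℝ :=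
  ⨆ x, (⟪xs, x⟫ - f x)

/-- The Bregman distance `D_f^{x*}(x, y) = f(y) - f(x) - ⟪x*, y - x⟫`. -/
def bregmanDist (f : E → ℝ) (xs x y : E) : ℝ :=
  f y - f x - ⟪xs, y - x⟫

/-- `z` is the Bregman projection of `x` onto `C` with respect to `f` and `xs`. -/
def IsBregmanProj (f : E → ℝ) (C : Set E) (xs x z : E) : Prop :=
  z ∈ C ∧ ∀ y ∈ C, bregmanDist f xs x z ≤ bregmanDist f xs x y

/-- `zs` is an admissible subgradient for the Bregman projection `z` (taken with respect to the
subgradient `xs`) onto `C`. -/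
def IsAdmissible (f : E → ℝ) (C : Set E) (xs z zs : E) : Prop :=
  zs ∈ subdiff f z ∧ ∀ y ∈ C, 0 ≤ ⟪zs - xs, y - z⟫

/-- `p` is the orthogonal (nearest point) projection of `v` onto `Q`. -/
def IsMetricProj (Q : Set E) (v p : E) : Prop :=
  p ∈ Q ∧ ∀ q ∈ Q, ‖v - p‖ ≤ ‖v - q‖

/-- The half-space `H_≤(u, β)`. -/
def halfSpace (u : E) (β : ℝ) : Set E := {x | ⟪u, x⟫ ≤ β}

/-- A set-valued mapping `S` is calm at `xhat`. -/
def CalmAt {F : Type*} [NormedAddCommGroup F] [NormedSpace ℝ F] (S : E → Set F) (xhat : E) :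
    Prop :=
  (S xhat).Nonempty ∧ ∃ ε > (0 : ℝ), ∃ L > (0 : ℝ), ∀ x, ‖x - xhat‖ ≤ ε →
    S x ⊆ S xhat + (L * ‖x - xhat‖) • Metric.closedBall (0 : F) 1

/-- A finite collection of (closed convex) sets with nonempty intersection is linearly regular. -/
def LinearlyRegular {ι : Type*} [Fintype ι] (C : ι → Set E) : Prop :=
  (⋂ i, C i).Nonempty ∧ ∃ γ > (0 : ℝ), ∀ x,
    Metric.infDist x (⋂ i, C i) ^ 2 ≤ γ * ∑ i, Metric.infDist x (C i) ^ 2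

end Convex

section Algorithm

variable {n : ℕ}

/-- One update `(x, x*) ↦ (z, z*)` for a constraint set `C` with index in `I_C`: `z` is the Bregman
projection onto `C` and `z*` is any admissible subgradient for it. -/
def ProjStep (f : EuclideanSpace ℝ (Fin n) → ℝ) (C : Set (EuclideanSpace ℝ (Fin n)))
    (x xs z zs : EuclideanSpace ℝ (Fin n)) : Prop :=
  IsBregmanProj f C xs x z ∧ IsAdmissible f C xs z zs

/-- One update `(x, x*) ↦ (z, z*)` for a constraint `B x ∈ Q` with index in `I_Q`: with
`w = B x - P_Q (B x)`, `u = Bᵀ w` and `β = ⟪u, x⟫ - ‖w‖²`, the point `z` is the Bregman projection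
onto `H_≤(u, β)`, and `z* = x* - t u ∈ ∂f(z)` where `t` minimizes `f*(x* - t u) + t β`. -/
def SplitStep (f : EuclideanSpace ℝ (Fin n) → ℝ) {κ : Type*} [Fintype κ] [DecidableEq κ]
    (B : Matrix κ (Fin n) ℝ) (Q : Set (EuclideanSpace ℝ κ))
    (x xs z zs : EuclideanSpace ℝ (Fin n)) : Prop :=
  ∃ p : EuclideanSpace ℝ κ, IsMetricProj Q (B.toEuclideanLin x) p ∧
    let w := B.toEuclideanLin x - p
    let u := B.transpose.toEuclideanLin w
    let β := ⟪u, x⟫ - ‖w‖ ^ 2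
    IsBregmanProj f (halfSpace u β) xs x z ∧ zs ∈ subdiff f z ∧
      ∃ t : ℝ, IsMinOn (fun s : ℝ => conjugate f (xs - s • u) + s * β) Set.univ t ∧
        zs = xs - t • u

/-- The rows of `A` indexed by `J`. -/
def rowBlock {m : ℕ} (A : Matrix (Fin m) (Fin n) ℝ) (J : Finset (Fin m)) : Matrix J (Fin n) ℝ :=
  A.submatrix Subtype.val id

/-- The entries of `b` indexed by `J`. -/
def entryBlock {m : ℕ} (b : EuclideanSpace ℝ (Fin m)) (J : Finset (Fin m)) :
    EuclideanSpace ℝ J :=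
  WithLp.toLp 2 fun j => b j

/-- The update of the algorithm for the constraints `A_i x = b_i` given by row blocks `I i`:
the constraint `i` is handled as a split constraint with `Q_i = {b_i}` when `i ∈ IQ`, and by the
Bregman projection onto `{x | A_i x = b_i}` otherwise. -/
def BlockStep {m r : ℕ} (f : EuclideanSpace ℝ (Fin n) → ℝ) (A : Matrix (Fin m) (Fin n) ℝ)
    (b : EuclideanSpace ℝ (Fin m)) (I : Fin r → Finset (Fin m)) (IQ : Set (Fin r)) (i : Fin r)
    (x xs z zs : EuclideanSpace ℝ (Fin n)) : Prop :=
  (i ∉ IQ → ProjStep f {y | (rowBlock A (I i)).toEuclideanLin y = entryBlock b (I i)} x xs z zs) ∧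
  (i ∈ IQ → SplitStep f (rowBlock A (I i)) {entryBlock b (I i)} x xs z zs)

/-- `(x k, xs k)` is a run of the randomized method with updates `step i`, started at `(x₀, x₀s)`.
`ℱ k` is the information available before the `k`-th index `idx k` is drawn: the index has law `p`
and is independent of `ℱ k`. The freedom in the choice of subgradients may be used in any
(nonanticipating, measurable, possibly random) way. -/
structure IsRandomizedRun {r : ℕ}
    (step : Fin r → EuclideanSpace ℝ (Fin n) → EuclideanSpace ℝ (Fin n) →
      EuclideanSpace ℝ (Fin n) → EuclideanSpace ℝ (Fin n) → Prop)
    (p : Fin r → ℝ) (x₀ x₀s : EuclideanSpace ℝ (Fin n))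
    {Ω : Type*} {mΩ : MeasurableSpace Ω} (P : Measure Ω) (ℱ : Filtration ℕ mΩ)
    (idx : ℕ → Ω → Fin r) (x xs : ℕ → Ω → EuclideanSpace ℝ (Fin n)) : Prop where
  measurable_idx : ∀ k, Measurable[ℱ (k + 1)] (idx k)
  law_idx : ∀ k i, P {ω | idx k ω = i} = ENNReal.ofReal (p i)
  indep_idx : ∀ k, Indep (ℱ k) (MeasurableSpace.comap (idx k) ⊤) P
  measurable_x : ∀ k, Measurable[ℱ k] (x k)
  measurable_xs : ∀ k, Measurable[ℱ k] (xs k)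
  init_x : ∀ ω, x 0 ω = x₀
  init_xs : ∀ ω, xs 0 ω = x₀s
  update : ∀ k ω, step (idx k ω) (x k ω) (xs k ω) (x (k + 1) ω) (xs (k + 1) ω)

end Algorithm

end BregmanSFP

/-! The Bregman distance `D` to `xhat` is a Lyapunov function. With `‖A h‖² ≤ N ‖h‖²`, an update
with block `i` lowers it by at least `α/(2N) ‖A_i (x_k - xhat)‖²`, whichever type the block has
(`blockStep_descent`). Since the index is independent of the past and the blocks cover all rows,
averaging turns this into a decrease by a multiple of `E ‖A (x_k - xhat)‖²`
(`IsRandomizedRun.integral_descent`).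

Contraction then needs `D ≤ K ‖A (x - xhat)‖²` (`exists_bregmanDist_le_sq_norm_map`). For `ys ∈
∂f(xhat) ∩ R(Aᵀ)` one has `D ≤ ⟪xs - ys, x - xhat⟫ ≤ C ‖xs - ys‖ ‖A (x - xhat)‖`, because `xs - ys`
is orthogonal to `ker A`. Taking `ys` nearest to `xs`, linear regularity and calmness bound `‖xs -
ys‖` by a multiple of `‖x - xhat‖`, hence of `√D`; cancel `√D`. The bound is uniform on the sublevel
set of the initial distance, which no run leaves, so the constants do not depend on the run. -/

namespace BregmanSFP

/-! ### Strong convexity, conjugates and Bregman distances -/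

section ConvexLemmas

variable {E : Type*} [NormedAddCommGroup E] [InnerProductSpace ℝ E] {f : E → ℝ} {α : ℝ}

theorem subdiff_add_sq_le (hf : StrongConvexOn Set.univ α f) {x xs : E}
    (h : xs ∈ subdiff f x) (y : E) : f x + ⟪xs, y - x⟫ + α / 2 * ‖y - x‖ ^ 2 ≤ f y := by
  -- Convexity on the segment loses a factor `1 - t`, recovered as `t → 0`.
  have key : ∀ t : ℝ, 0 < t → t < 1 →
      f x + ⟪xs, y - x⟫ + (1 - t) * (α / 2 * ‖y - x‖ ^ 2) ≤ f y := by
    intro t ht ht1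
    have h1 := hf.2 (Set.mem_univ x) (Set.mem_univ y) (sub_nonneg.2 ht1.le) ht.le (by ring)
    have h2 := h ((1 - t) • x + t • y)
    have h3 : (1 - t) • x + t • y - x = t • (y - x) := by module
    rw [h3, inner_smul_right] at h2
    simp only [smul_eq_mul] at h1
    rw [norm_sub_rev x y] at h1
    have h4 : t * (f x + ⟪xs, y - x⟫ + (1 - t) * (α / 2 * ‖y - x‖ ^ 2)) ≤ t * f y := by
      linarith
    exact le_of_mul_le_mul_left h4 ht
  have lim : Tendsto (fun t : ℝ => f x + ⟪xs, y - x⟫ + (1 - t) * (α / 2 * ‖y - x‖ ^ 2))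
      (𝓝[>] 0) (𝓝 (f x + ⟪xs, y - x⟫ + (1 - 0) * (α / 2 * ‖y - x‖ ^ 2))) :=
    (Continuous.tendsto (by fun_prop) _).mono_left nhdsWithin_le_nhds
  rw [sub_zero, one_mul] at lim
  refine le_of_tendsto lim ?_
  filter_upwards [Ioo_mem_nhdsGT (zero_lt_one' ℝ)] with t ht using key t ht.1 ht.2

theorem sq_norm_le_bregmanDist (hf : StrongConvexOn Set.univ α f) {x xs : E}
    (h : xs ∈ subdiff f x) (y : E) : α / 2 * ‖y - x‖ ^ 2 ≤ bregmanDist f xs x y := by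
  have := subdiff_add_sq_le hf h y
  unfold bregmanDist
  linarith

theorem bregmanDist_nonneg {x xs : E} (h : xs ∈ subdiff f x) (y : E) :
    0 ≤ bregmanDist f xs x y := by
  have := h y
  unfold bregmanDist
  linarith

theorem inner_sub_le_of_subdiff (hα : 0 < α) (hf : StrongConvexOn Set.univ α f) {x xs : E}
    (h : xs ∈ subdiff f x) (v y : E) :
    ⟪xs + v, y⟫ - f y ≤ ⟪xs, x⟫ - f x + ⟪v, x⟫ + ‖v‖ ^ 2 / (2 * α) := by
  have h1 := subdiff_add_sq_le hf h y
  have h2 : ⟪v, y - x⟫ ≤ ‖v‖ * ‖y - x‖ := real_inner_le_norm _ _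
  have h3 : ‖v‖ * ‖y - x‖ ≤ ‖v‖ ^ 2 / (2 * α) + α / 2 * ‖y - x‖ ^ 2 := by
    have e : ‖v‖ ^ 2 / (2 * α) + α / 2 * ‖y - x‖ ^ 2 - ‖v‖ * ‖y - x‖ =
        (‖v‖ - α * ‖y - x‖) ^ 2 / (2 * α) := by field_simp; ring
    have : 0 ≤ (‖v‖ - α * ‖y - x‖) ^ 2 / (2 * α) := by positivity
    linarith
  simp only [inner_sub_right, inner_add_left] at *
  linarith

theorem bddAbove_conjugate (hα : 0 < α) (hf : StrongConvexOn Set.univ α f) {x xs : E}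
    (h : xs ∈ subdiff f x) (ys : E) : BddAbove (Set.range fun y => ⟪ys, y⟫ - f y) := by
  refine ⟨⟪xs, x⟫ - f x + ⟪ys - xs, x⟫ + ‖ys - xs‖ ^ 2 / (2 * α), ?_⟩
  rintro _ ⟨y, rfl⟩
  simpa using inner_sub_le_of_subdiff hα hf h (ys - xs) y

theorem conjugate_eq_of_subdiff {x xs : E} (h : xs ∈ subdiff f x) :
    conjugate f xs = ⟪xs, x⟫ - f x := by
  have hle : ∀ y, ⟪xs, y⟫ - f y ≤ ⟪xs, x⟫ - f x := by
    intro y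
    have := h y
    rw [inner_sub_right] at this
    linarith
  exact le_antisymm (ciSup_le hle) (le_ciSup ⟨_, Set.forall_mem_range.2 hle⟩ x)

/-- Smoothness of the conjugate, dual to strong convexity of `f`: the quadratic upper model for the
line search in `splitStep_descent`. -/
theorem conjugate_add_le (hα : 0 < α) (hf : StrongConvexOn Set.univ α f) {x xs : E}
    (h : xs ∈ subdiff f x) (v : E) :
    conjugate f (xs + v) ≤ conjugate f xs + ⟪v, x⟫ + ‖v‖ ^ 2 / (2 * α) := by
  rw [conjugate_eq_of_subdiff h]
  exact ciSup_le (inner_sub_le_of_subdiff hα hf h v)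

theorem le_conjugate_add (hα : 0 < α) (hf : StrongConvexOn Set.univ α f) {x xs : E}
    (h : xs ∈ subdiff f x) (v : E) :
    conjugate f xs + ⟪v, x⟫ ≤ conjugate f (xs + v) := by
  rw [conjugate_eq_of_subdiff h]
  refine le_trans (le_of_eq ?_) (le_ciSup (bddAbove_conjugate hα hf h (xs + v)) x)
  rw [inner_add_left]
  ring

theorem hasGradientAt_conjugate [CompleteSpace E] (hα : 0 < α)
    (hf : StrongConvexOn Set.univ α f) {x xs : E} (h : xs ∈ subdiff f x) :
    HasGradientAt (conjugate f) x xs := by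
  rw [hasGradientAt_iff_isLittleO_nhds_zero]
  refine Asymptotics.IsBigO.trans_isLittleO (g := fun v : E => ‖v‖ ^ 2) ?_ ?_
  · refine Asymptotics.IsBigO.of_bound (1 / (2 * α)) (Eventually.of_forall fun v => ?_)
    have h1 := conjugate_add_le hα hf h v
    have h2 := le_conjugate_add hα hf h v
    rw [real_inner_comm] at h1 h2
    rw [Real.norm_of_nonneg (by linarith), Real.norm_of_nonneg (by positivity)]
    have : 1 / (2 * α) * ‖v‖ ^ 2 = ‖v‖ ^ 2 / (2 * α) := by ring
    linarith
  · exact Asymptotics.isLittleO_norm_pow_id one_lt_two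

/-- For fixed `y` only the dual variable remains on the right, so a dual line search acts directly
on the distance to `y`. -/
theorem bregmanDist_eq_conjugate {x xs : E} (h : xs ∈ subdiff f x) (y : E) :
    bregmanDist f xs x y = f y + conjugate f xs - ⟪xs, y⟫ := by
  rw [conjugate_eq_of_subdiff h, bregmanDist, inner_sub_right]
  ring

/-- The two opposite Bregman distances sum to the right-hand side; drop the nonnegative one based at
`y`. -/
theorem bregmanDist_le_inner {x xs y ys : E} (hy : ys ∈ subdiff f y) :
    bregmanDist f xs x y ≤ ⟪xs - ys, x - y⟫ := by
  have := hy x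
  simp only [bregmanDist, inner_sub_right, inner_sub_left] at *
  linarith

/-- Three-point identity `D(x,y) = D(x,z) + D(z,y) + ⟪zs - xs, y - z⟫`, whose last term is
nonnegative by admissibility. -/
theorem bregmanDist_le_of_isAdmissible (hf : StrongConvexOn Set.univ α f) {C : Set E}
    {x xs z zs y : E} (hx : xs ∈ subdiff f x) (hz : IsAdmissible f C xs z zs) (hy : y ∈ C) :
    bregmanDist f zs z y ≤ bregmanDist f xs x y - α / 2 * ‖z - x‖ ^ 2 := by
  have h1 := sq_norm_le_bregmanDist hf hx z
  have h2 := hz.2 y hy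
  simp only [bregmanDist, inner_sub_right, inner_sub_left] at *
  linarith

theorem isClosed_subdiff (x : E) : IsClosed (subdiff f x) := by
  simp only [subdiff, Set.ofPred_forall]
  exact isClosed_iInter fun y => isClosed_le (by fun_prop) continuous_const

variable [FiniteDimensional ℝ E]

theorem continuous_of_strongConvexOn (hα : 0 ≤ α) (hf : StrongConvexOn Set.univ α f) :
    Continuous f := by
  have : ConvexOn ℝ Set.univ f := hf.convexOn (fun r => by positivity)
  rw [← continuousOn_univ]
  exact this.continuousOn isOpen_univ

/-- A strongly convex function with a subgradient somewhere has every vector as a subgradient. -/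
theorem exists_mem_subdiff (hα : 0 < α) (hf : StrongConvexOn Set.univ α f) {y ys : E}
    (hy : ys ∈ subdiff f y) (xs : E) : ∃ x, xs ∈ subdiff f x := by
  have hc := continuous_of_strongConvexOn hα.le hf
  have : ∀ᶠ x in cocompact E, f y - ⟪xs, y⟫ ≤ f x - ⟪xs, x⟫ := by
    have hlim := (tendsto_norm_cocompact_atTop (E := E)).eventually_ge_atTop
      (‖y‖ + 2 * ‖xs - ys‖ / α)
    filter_upwards [hlim] with x hx
    have h1 := subdiff_add_sq_le hf hy x
    have h2 : ⟪xs - ys, x - y⟫ ≤ ‖xs - ys‖ * ‖x - y‖ := real_inner_le_norm _ _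
    -- Beyond this radius the quadratic growth of `f` beats the linear perturbation.
    have h3 : 2 * ‖xs - ys‖ / α ≤ ‖x - y‖ := by linarith [norm_sub_norm_le x y]
    rw [div_le_iff₀ hα] at h3
    have h4 := mul_le_mul_of_nonneg_right h3 (norm_nonneg (x - y))
    simp only [inner_sub_right, inner_sub_left] at *
    nlinarith
  obtain ⟨x, hx⟩ := Continuous.exists_forall_le' (f := fun x => f x - ⟪xs, x⟫) (by fun_prop) y this
  refine ⟨x, fun z => ?_⟩
  have := hx z
  rw [inner_sub_right]
  linarith

theorem mem_subdiff_gradient_conjugate (hα : 0 < α) (hf : StrongConvexOn Set.univ α f) {y ys : E}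
    (hy : ys ∈ subdiff f y) (xs : E) :
    letI := FiniteDimensional.complete ℝ E
    xs ∈ subdiff f (∇ (conjugate f) xs) := by
  let := FiniteDimensional.complete ℝ E
  obtain ⟨x, hx⟩ := exists_mem_subdiff hα hf hy xs
  rwa [(hasGradientAt_conjugate hα hf hx).gradient]

/-- Subgradients of a continuous function are bounded on bounded sets. -/
theorem exists_norm_le_of_mem_subdiff (hf : Continuous f) (y : E) (R : ℝ) :
    ∃ M : ℝ, ∀ x xs, ‖x - y‖ ≤ R → xs ∈ subdiff f x → ‖xs‖ ≤ M := by
  have := FiniteDimensional.proper ℝ E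
  obtain ⟨K, hK⟩ := (isCompact_closedBall y (R + 1)).exists_bound_of_continuousOn hf.continuousOn
  refine ⟨2 * K, fun x xs hx h => ?_⟩
  -- A unit step along `xs` raises `f` by at least `‖xs‖`. For `xs = 0` the step is `0`, which is
  -- harmless.
  have h1 := h (x + ‖xs‖⁻¹ • xs)
  have hn : ‖‖xs‖⁻¹ • xs‖ ≤ 1 := by
    rw [norm_smul, norm_inv, norm_norm]
    exact inv_mul_le_one
  have h2 := hK x (by rw [mem_closedBall_iff_norm]; linarith)
  have h3 := hK (x + ‖xs‖⁻¹ • xs) (by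
    rw [mem_closedBall_iff_norm, add_sub_right_comm]
    linarith [norm_add_le (x - y) (‖xs‖⁻¹ • xs)])
  have h4 : ⟪xs, x + ‖xs‖⁻¹ • xs - x⟫ = ‖xs‖ := by
    rw [add_sub_cancel_left, inner_smul_right, real_inner_self_eq_norm_sq]
    rcases eq_or_ne ‖xs‖ 0 with h0 | h0
    · simp [h0]
    · field_simp
  rw [h4] at h1
  rw [Real.norm_eq_abs, abs_le] at h2 h3
  linarith

/-- Calmness at a point extends to bounded sets. -/
theorem exists_infDist_subdiff_le (hα : 0 ≤ α) (hf : StrongConvexOn Set.univ α f) {xhat : E}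
    (hcalm : CalmAt (subdiff f) xhat) (R : ℝ) :
    ∃ L > (0 : ℝ), ∀ x xs, ‖x - xhat‖ ≤ R → xs ∈ subdiff f x →
      Metric.infDist xs (subdiff f xhat) ≤ L * ‖x - xhat‖ := by
  obtain ⟨⟨ys, hys⟩, ε, hε, L, hL, hcalm⟩ := hcalm
  obtain ⟨M, hM⟩ := exists_norm_le_of_mem_subdiff (continuous_of_strongConvexOn hα hf) xhat R
  -- Outside the calmness ball `‖x - xhat‖ ≥ ε`, so the uniform bound on subgradients is itself
  -- linear in `‖x - xhat‖`.
  refine ⟨max L ((|M| + ‖ys‖) / ε), lt_max_of_lt_left hL, fun x xs hx hxs => ?_⟩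
  rcases le_total ‖x - xhat‖ ε with h | h
  · obtain ⟨zs, hzs, e, he, rfl⟩ := Set.mem_add.1 (hcalm x h hxs)
    obtain ⟨e, he', rfl⟩ := Set.mem_smul_set.1 he
    rw [mem_closedBall_zero_iff] at he'
    refine (Metric.infDist_le_dist_of_mem hzs).trans ?_
    rw [dist_eq_norm, add_sub_cancel_left, norm_smul, Real.norm_of_nonneg (by positivity)]
    calc L * ‖x - xhat‖ * ‖e‖ ≤ L * ‖x - xhat‖ := mul_le_of_le_one_right (by positivity) he'
      _ ≤ _ := by gcongr; exact le_max_left _ _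
  · refine (Metric.infDist_le_dist_of_mem hys).trans ?_
    rw [dist_eq_norm]
    calc ‖xs - ys‖ ≤ ‖xs‖ + ‖ys‖ := norm_sub_le _ _
      _ ≤ |M| + ‖ys‖ := by gcongr; exact (hM x xs hx hxs).trans (le_abs_self M)
      _ = (|M| + ‖ys‖) / ε * ε := by field_simp
      _ ≤ _ := by gcongr; exact le_max_right _ _

end ConvexLemmas

/-! ### Linear maps and orthogonal complements of kernels -/

section LinearLemmas

variable {E F : Type*} [NormedAddCommGroup E] [InnerProductSpace ℝ E] [FiniteDimensional ℝ E]
  [NormedAddCommGroup F] [NormedSpace ℝ F]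

/-- Both `⟪v, h⟫` and `T h` see only the component of `h` in `(ker T)ᗮ`, where `T` is injective and
hence bounded below. -/
theorem exists_inner_le_norm_mul_norm_map (T : E →ₗ[ℝ] F) :
    ∃ K > (0 : ℝ), ∀ v ∈ (LinearMap.ker T)ᗮ, ∀ h, ⟪v, h⟫ ≤ K * ‖v‖ * ‖T h‖ := by
  obtain ⟨K, hK, hT⟩ := (T.domRestrict (LinearMap.ker T)ᗮ).exists_antilipschitzWith (by
    rw [LinearMap.ker_eq_bot']
    rintro ⟨v, hv⟩ h0
    have : v ∈ LinearMap.ker T := h0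
    have := Submodule.inner_right_of_mem_orthogonal this hv
    ext
    simpa using this)
  refine ⟨K, hK, fun v hv h => ?_⟩
  set P := (LinearMap.ker T)ᗮ.orthogonalProjectionOnto h
  have h1 : h - (P : E) ∈ LinearMap.ker T := by
    have := Submodule.sub_starProjection_mem_orthogonal (K := (LinearMap.ker T)ᗮ) h
    rwa [Submodule.orthogonal_orthogonal] at this
  have h2 : T h = T P := by
    rw [LinearMap.mem_ker, map_sub, sub_eq_zero] at h1
    exact h1
  have h3 : ⟪v, h⟫ = ⟪v, (P : E)⟫ := by
    have := Submodule.inner_left_of_mem_orthogonal h1 hv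
    rw [inner_sub_right, sub_eq_zero] at this
    exact this
  have h4 : ‖(P : E)‖ ≤ K * ‖T P‖ := by simpa [dist_zero_right] using hT.le_mul_dist P 0
  calc ⟪v, h⟫ = ⟪v, (P : E)⟫ := h3
    _ ≤ ‖v‖ * ‖(P : E)‖ := real_inner_le_norm _ _
    _ ≤ ‖v‖ * (K * ‖T P‖) := by gcongr
    _ = K * ‖v‖ * ‖T h‖ := by rw [h2]; ring

theorem range_toEuclideanLin_transpose {κ ι : Type*} [Fintype κ] [DecidableEq κ] [Fintype ι]
    [DecidableEq ι] (B : Matrix κ ι ℝ) :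
    LinearMap.range B.transpose.toEuclideanLin = (LinearMap.ker B.toEuclideanLin)ᗮ := by
  rw [← Matrix.conjTranspose_eq_transpose_of_trivial,
    Matrix.toEuclideanLin_conjTranspose_eq_adjoint, LinearMap.orthogonal_ker]

theorem inner_toEuclideanLin_transpose {κ ι : Type*} [Fintype κ] [DecidableEq κ] [Fintype ι]
    [DecidableEq ι] (B : Matrix κ ι ℝ) (w : EuclideanSpace ℝ κ) (x : EuclideanSpace ℝ ι) :
    ⟪B.transpose.toEuclideanLin w, x⟫ = ⟪w, B.toEuclideanLin x⟫ := by
  rw [← Matrix.conjTranspose_eq_transpose_of_trivial,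
    Matrix.toEuclideanLin_conjTranspose_eq_adjoint, LinearMap.adjoint_inner_left]

theorem exists_norm_map_le {F : Type*} [NormedAddCommGroup F] [NormedSpace ℝ F] (T : E →ₗ[ℝ] F) :
    ∃ N > (0 : ℝ), ∀ h, ‖T h‖ ^ 2 ≤ N * ‖h‖ ^ 2 := by
  obtain ⟨c, hc, h⟩ := T.toContinuousLinearMap.bound
  refine ⟨c ^ 2, by positivity, fun x => ?_⟩
  rw [← mul_pow]
  gcongr
  exact h x

end LinearLemmas

/-! ### Error bound by the residual -/

section ErrorBound

variable {E F : Type*} [NormedAddCommGroup E] [InnerProductSpace ℝ E] [FiniteDimensional ℝ E]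
  [NormedAddCommGroup F] [NormedSpace ℝ F] {f : E → ℝ} {α : ℝ}

/-- Error bound: on sublevel sets, the Bregman distance to the solution of a linearly constrained
problem is controlled by the squared residual. -/
theorem exists_bregmanDist_le_sq_norm_map (hα : 0 < α) (hf : StrongConvexOn Set.univ α f)
    {xhat : E} (hcalm : CalmAt (subdiff f) xhat) (T : E →ₗ[ℝ] F)
    (hreg : LinearlyRegular ![subdiff f xhat, ((LinearMap.ker T)ᗮ : Set E)]) (D : ℝ) :
    ∃ K > (0 : ℝ), ∀ x xs, xs ∈ subdiff f x → xs ∈ (LinearMap.ker T)ᗮ →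
      bregmanDist f xs x xhat ≤ D → bregmanDist f xs x xhat ≤ K * ‖T (x - xhat)‖ ^ 2 := by
  obtain ⟨C, hC, hT⟩ := exists_inner_le_norm_mul_norm_map T
  -- Strong convexity gives `‖x - xhat‖² ≤ 2|D|/α`, and `s² ≤ c` implies `s ≤ c + 1`.
  obtain ⟨L, hL, hsub⟩ := exists_infDist_subdiff_le hα.le hf hcalm (2 * |D| / α + 1)
  obtain ⟨hne, γ, hγ, hreg⟩ := hreg
  have hInter : (⋂ i, ![subdiff f xhat, ((LinearMap.ker T)ᗮ : Set E)] i) =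
      subdiff f xhat ∩ ((LinearMap.ker T)ᗮ : Set E) := by
    ext v
    simp [Fin.forall_fin_two]
  rw [hInter] at hne hreg
  have hclosed : IsClosed (subdiff f xhat ∩ ((LinearMap.ker T)ᗮ : Set E)) :=
    (isClosed_subdiff xhat).inter (Submodule.isClosed_orthogonal _)
  refine ⟨C ^ 2 * γ * L ^ 2 * (2 / α), by positivity, fun x xs hx hxT hD => ?_⟩
  have := FiniteDimensional.proper ℝ E
  obtain ⟨ys, ⟨hys, hysT⟩, hdist⟩ := hclosed.exists_infDist_eq_dist hne xs
  have h1 := sq_norm_le_bregmanDist hf hx xhat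
  have h0 := bregmanDist_nonneg hx xhat
  have hsq : ‖x - xhat‖ ^ 2 ≤ 2 / α * bregmanDist f xs x xhat := by
    rw [norm_sub_rev] at h1
    rw [div_mul_eq_mul_div, le_div_iff₀ hα]
    linarith
  have hR : ‖x - xhat‖ ≤ 2 * |D| / α + 1 := by
    have : ‖x - xhat‖ ^ 2 ≤ 2 * |D| / α := by
      refine hsq.trans ?_
      rw [div_mul_eq_mul_div]
      gcongr
      exact hD.trans (le_abs_self D)
    nlinarith [sq_nonneg (‖x - xhat‖ - 1), norm_nonneg (x - xhat)]
  have h2 : ‖xs - ys‖ ^ 2 ≤ γ * (L * ‖x - xhat‖) ^ 2 := by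
    have h3 := hreg xs
    rw [Fin.sum_univ_two, hdist, dist_eq_norm] at h3
    simp only [Matrix.cons_val_zero, Matrix.cons_val_one] at h3
    -- Since `xs` already lies in `(ker T)ᗮ`, only its distance to `∂f(xhat)` remains.
    rw [Metric.infDist_zero_of_mem (s := ((LinearMap.ker T)ᗮ : Set E)) hxT] at h3
    refine h3.trans ?_
    have := hsub x xs hR hx
    have := Metric.infDist_nonneg (x := xs) (s := subdiff f xhat)
    simp only [ne_eq, OfNat.ofNat_ne_zero, not_false_eq_true, zero_pow, add_zero]
    gcongr
  have h3 : bregmanDist f xs x xhat ≤ C * ‖xs - ys‖ * ‖T (x - xhat)‖ :=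
    (bregmanDist_le_inner hys).trans (hT _ (Submodule.sub_mem _ hxT hysT) _)
  -- Squaring yields `D² ≤ const · D · ‖T (x - xhat)‖²`; a factor `D` is cancelled when positive.
  rcases h0.eq_or_lt with h | h
  · rw [← h]; positivity
  refine le_of_mul_le_mul_left ?_ h
  calc bregmanDist f xs x xhat * bregmanDist f xs x xhat
      ≤ (C * ‖xs - ys‖ * ‖T (x - xhat)‖) * (C * ‖xs - ys‖ * ‖T (x - xhat)‖) := by gcongr
    _ = C ^ 2 * ‖xs - ys‖ ^ 2 * ‖T (x - xhat)‖ ^ 2 := by ring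
    _ ≤ C ^ 2 * (γ * (L ^ 2 * (2 / α * bregmanDist f xs x xhat))) * ‖T (x - xhat)‖ ^ 2 := by
        gcongr
        refine h2.trans ?_
        rw [mul_pow]
        gcongr
    _ = _ := by ring

end ErrorBound

/-! ### Deterministic descent of a single update -/

section Steps

variable {n : ℕ} {f : EuclideanSpace ℝ (Fin n) → ℝ} {α : ℝ}
  {x xs z zs xhat : EuclideanSpace ℝ (Fin n)}

/-- Since `T z = T xhat`, the residual is at most `√N ‖z - x‖`. Testing admissibility with `z ± v`,
`v ∈ ker T`, gives the orthogonality. -/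
theorem projStep_descent (hα : 0 < α) (hf : StrongConvexOn Set.univ α f) {F : Type*}
    [NormedAddCommGroup F] [NormedSpace ℝ F] (T : EuclideanSpace ℝ (Fin n) →ₗ[ℝ] F) {N : ℝ}
    (hN : 0 < N) (hTN : ∀ h, ‖T h‖ ^ 2 ≤ N * ‖h‖ ^ 2) (hx : xs ∈ subdiff f x)
    (hstep : ProjStep f {y | T y = T xhat} x xs z zs) :
    zs ∈ subdiff f z ∧ zs - xs ∈ (LinearMap.ker T)ᗮ ∧
      bregmanDist f zs z xhat ≤
        bregmanDist f xs x xhat - α / (2 * N) * ‖T (x - xhat)‖ ^ 2 := by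
  obtain ⟨⟨hz, -⟩, hadm⟩ := hstep
  have hz : T z = T xhat := hz
  refine ⟨hadm.1, ?_, ?_⟩
  · rw [Submodule.mem_orthogonal']
    intro v hv
    rw [LinearMap.mem_ker] at hv
    have h1 := hadm.2 (z + v) (by simp [hz, hv])
    have h2 := hadm.2 (z - v) (by simp [hz, hv])
    rw [add_sub_cancel_left] at h1
    rw [sub_sub_cancel_left, inner_neg_right] at h2
    linarith
  · refine (bregmanDist_le_of_isAdmissible hf hx hadm (y := xhat) rfl).trans ?_
    have h1 := hTN (z - x)
    have h2 : ‖T (x - xhat)‖ = ‖T (z - x)‖ := by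
      rw [map_sub, map_sub, hz, norm_sub_rev]
    rw [h2]
    have : α / (2 * N) * ‖T (z - x)‖ ^ 2 ≤ α / (2 * N) * (N * ‖z - x‖ ^ 2) := by gcongr
    have e : α / (2 * N) * (N * ‖z - x‖ ^ 2) = α / 2 * ‖z - x‖ ^ 2 := by field_simp
    linarith

/-- Here `β = ⟪u, xhat⟫`, so the line search objective is the Bregman distance to `xhat` up to a
constant, and any trial step size bounds the minimum. -/
theorem splitStep_descent (hα : 0 < α) (hf : StrongConvexOn Set.univ α f) {κ : Type*} [Fintype κ]
    [DecidableEq κ] (B : Matrix κ (Fin n) ℝ) {N : ℝ} (hN : 0 < N)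
    (hBN : ∀ h, ‖B.toEuclideanLin h‖ ^ 2 ≤ N * ‖h‖ ^ 2) (hx : xs ∈ subdiff f x)
    (hstep : SplitStep f B {B.toEuclideanLin xhat} x xs z zs) :
    zs ∈ subdiff f z ∧ zs - xs ∈ (LinearMap.ker B.toEuclideanLin)ᗮ ∧
      bregmanDist f zs z xhat ≤
        bregmanDist f xs x xhat - α / (2 * N) * ‖B.toEuclideanLin (x - xhat)‖ ^ 2 := by
  obtain ⟨p, ⟨hp, -⟩, -, hz, t, ht, rfl⟩ := hstep
  obtain rfl : p = B.toEuclideanLin xhat := hp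
  rw [← map_sub] at *
  set w := B.toEuclideanLin (x - xhat) with hw
  set u := B.transpose.toEuclideanLin w with hu
  refine ⟨hz, ?_, ?_⟩
  · rw [sub_sub_cancel_left, ← range_toEuclideanLin_transpose]
    exact Submodule.neg_mem _ (Submodule.smul_mem _ _ ⟨w, rfl⟩)
  · rw [bregmanDist_eq_conjugate hz, bregmanDist_eq_conjugate hx]
    have hux : ⟪u, x - xhat⟫ = ‖w‖ ^ 2 := by
      rw [hu, inner_toEuclideanLin_transpose, ← hw, real_inner_self_eq_norm_sq]
    have huN : ‖u‖ ^ 2 ≤ N * ‖w‖ ^ 2 := by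
      have h1 : ‖u‖ ^ 2 ≤ ‖w‖ * ‖B.toEuclideanLin u‖ := by
        rw [← real_inner_self_eq_norm_sq, ← real_inner_comm, hu, inner_toEuclideanLin_transpose]
        exact real_inner_le_norm _ _
      rcases (norm_nonneg u).eq_or_lt with h0 | h0
      · rw [← h0]; simp only [ne_eq, OfNat.ofNat_ne_zero, not_false_eq_true, zero_pow]
        positivity
      · refine le_of_mul_le_mul_left ?_ (by positivity : 0 < ‖u‖ ^ 2)
        calc ‖u‖ ^ 2 * ‖u‖ ^ 2 ≤ (‖w‖ * ‖B.toEuclideanLin u‖) * (‖w‖ * ‖B.toEuclideanLin u‖) := by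
              gcongr
          _ = ‖w‖ ^ 2 * ‖B.toEuclideanLin u‖ ^ 2 := by ring
          _ ≤ ‖w‖ ^ 2 * (N * ‖u‖ ^ 2) := by gcongr; exact hBN u
          _ = _ := by ring
    -- The trial step `α/N` minimizes the upper model `-t ‖w‖² + t² N ‖w‖² / (2α)`.
    have h1 := (isMinOn_iff.1 ht) (α / N) (Set.mem_univ _)
    have h2 := conjugate_add_le hα hf hx (-((α / N) • u))
    rw [← sub_eq_add_neg, inner_neg_left, inner_smul_left, norm_neg, norm_smul,
      Real.norm_of_nonneg (by positivity)] at h2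
    rw [inner_sub_right] at hux
    rw [inner_sub_left, inner_smul_left]
    simp only [conj_trivial] at *
    have h3 : (α / N * ‖u‖) ^ 2 / (2 * α) ≤ α / (2 * N) * ‖w‖ ^ 2 := by
      calc (α / N * ‖u‖) ^ 2 / (2 * α) = α / (2 * N ^ 2) * ‖u‖ ^ 2 := by field_simp
        _ ≤ α / (2 * N ^ 2) * (N * ‖w‖ ^ 2) := by gcongr
        _ = _ := by field_simp
    have e : α / N * ‖w‖ ^ 2 = 2 * (α / (2 * N) * ‖w‖ ^ 2) := by field_simp
    have e1 : ⟪u, x⟫ - ‖w‖ ^ 2 = ⟪u, xhat⟫ := by linarith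
    have e2 : ⟪u, xhat⟫ = ⟪u, x⟫ - ‖w‖ ^ 2 := e1.symm
    rw [e1] at h1
    have e3 : α / N * ⟪u, xhat⟫ = α / N * ⟪u, x⟫ - α / N * ‖w‖ ^ 2 := by rw [e2]; ring
    linarith

variable {m : ℕ} (A : Matrix (Fin m) (Fin n) ℝ) (J : Finset (Fin m))

theorem sq_norm_rowBlock (h : EuclideanSpace ℝ (Fin n)) :
    ‖(rowBlock A J).toEuclideanLin h‖ ^ 2 = ∑ j ∈ J, (A.toEuclideanLin h j) ^ 2 := by
  rw [EuclideanSpace.real_norm_sq_eq, ← Finset.sum_coe_sort J]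
  rfl

theorem rowBlock_toEuclideanLin (h : EuclideanSpace ℝ (Fin n)) :
    (rowBlock A J).toEuclideanLin h = entryBlock (A.toEuclideanLin h) J := rfl

theorem sq_norm_rowBlock_le (h : EuclideanSpace ℝ (Fin n)) :
    ‖(rowBlock A J).toEuclideanLin h‖ ^ 2 ≤ ‖A.toEuclideanLin h‖ ^ 2 := by
  rw [sq_norm_rowBlock, EuclideanSpace.real_norm_sq_eq]
  exact Finset.sum_le_sum_of_subset_of_nonneg (Finset.subset_univ J) fun j _ _ => sq_nonneg _

theorem ker_le_ker_rowBlock :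
    LinearMap.ker A.toEuclideanLin ≤ LinearMap.ker (rowBlock A J).toEuclideanLin := by
  intro h hh
  have := sq_norm_rowBlock_le A J h
  rw [LinearMap.mem_ker.1 hh, norm_zero] at this
  rw [LinearMap.mem_ker, ← norm_eq_zero]
  nlinarith [norm_nonneg ((rowBlock A J).toEuclideanLin h)]

theorem sq_norm_le_sum_sq_norm_rowBlock {r : ℕ} {I : Fin r → Finset (Fin m)}
    (hI : ∀ j, ∃ i, j ∈ I i) (h : EuclideanSpace ℝ (Fin n)) :
    ‖A.toEuclideanLin h‖ ^ 2 ≤ ∑ i, ‖(rowBlock A (I i)).toEuclideanLin h‖ ^ 2 := by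
  simp only [sq_norm_rowBlock]
  rw [EuclideanSpace.real_norm_sq_eq]
  calc ∑ j, A.toEuclideanLin h j ^ 2
      ≤ ∑ j, ∑ i, if j ∈ I i then A.toEuclideanLin h j ^ 2 else 0 := by
        refine Finset.sum_le_sum fun j _ => ?_
        obtain ⟨i, hi⟩ := hI j
        refine le_trans (by simp [hi]) (Finset.single_le_sum
          (f := fun i => if j ∈ I i then A.toEuclideanLin h j ^ 2 else 0)
          (fun i _ => by positivity) (Finset.mem_univ i))
    _ = _ := by
        rw [Finset.sum_comm]
        simp

/-- Deleting rows does not increase the norm, so one `N` serves all blocks; block row spaces lie in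
that of `A`, so subgradients stay there. -/
theorem blockStep_descent (hα : 0 < α) (hf : StrongConvexOn Set.univ α f) {N : ℝ} (hN : 0 < N)
    (hAN : ∀ h, ‖A.toEuclideanLin h‖ ^ 2 ≤ N * ‖h‖ ^ 2) {r : ℕ} {I : Fin r → Finset (Fin m)}
    {IQ : Set (Fin r)} {i : Fin r} (hx : xs ∈ subdiff f x)
    (hxA : xs ∈ (LinearMap.ker A.toEuclideanLin)ᗮ)
    (hstep : BlockStep f A (A.toEuclideanLin xhat) I IQ i x xs z zs) :
    zs ∈ subdiff f z ∧ zs ∈ (LinearMap.ker A.toEuclideanLin)ᗮ ∧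
      bregmanDist f zs z xhat ≤ bregmanDist f xs x xhat -
        α / (2 * N) * ‖(rowBlock A (I i)).toEuclideanLin (x - xhat)‖ ^ 2 := by
  have hBN h := (sq_norm_rowBlock_le A (I i) h).trans (hAN h)
  rw [BlockStep, ← rowBlock_toEuclideanLin] at hstep
  have key : zs ∈ subdiff f z ∧ zs - xs ∈ (LinearMap.ker (rowBlock A (I i)).toEuclideanLin)ᗮ ∧
      bregmanDist f zs z xhat ≤ bregmanDist f xs x xhat -
        α / (2 * N) * ‖(rowBlock A (I i)).toEuclideanLin (x - xhat)‖ ^ 2 := by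
    by_cases hi : i ∈ IQ
    · exact splitStep_descent hα hf _ hN hBN hx (hstep.2 hi)
    · exact projStep_descent hα hf _ hN hBN hx (hstep.1 hi)
  refine ⟨key.1, ?_, key.2.2⟩
  have := Submodule.orthogonal_le (ker_le_ker_rowBlock A (I i)) key.2.1
  simpa using Submodule.add_mem _ this hxA

end Steps

/-! ### Averaging over an independent index -/

section Probability

/-- Split according to the value of the index; each indicator is independent of the `m`-measurable
`G i`. -/
theorem integral_comp_index_of_indep {Ω : Type*} {m mΩ : MeasurableSpace Ω} {P : Measure Ω} {r : ℕ} {p : Fin r → ℝ}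
    (hp : ∀ i, 0 ≤ p i) (hm : m ≤ mΩ) {idx : Ω → Fin r}
    (hidx : Measurable idx) (hlaw : ∀ i, P {ω | idx ω = i} = ENNReal.ofReal (p i))
    (hindep : Indep m (MeasurableSpace.comap idx ⊤) P) {G : Fin r → Ω → ℝ}
    (hG : ∀ i, Measurable[m] (G i)) (hint : ∀ i, Integrable (G i) P) :
    Integrable (fun ω => G (idx ω) ω) P ∧ ∫ ω, G (idx ω) ω ∂P = ∑ i, p i * ∫ ω, G i ω ∂P := by
  have hset i : MeasurableSet {ω | idx ω = i} := hidx (measurableSet_singleton i)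
  have hsum : (fun ω => G (idx ω) ω) =
      fun ω => ∑ i, {ω | idx ω = i}.indicator (G i) ω := by
    ext ω
    simp [Set.indicator_apply]
  have hI i : Integrable ({ω | idx ω = i}.indicator (G i)) P := (hint i).indicator (hset i)
  rw [hsum]
  refine ⟨integrable_finsetSum _ fun i _ => hI i, ?_⟩
  rw [integral_finsetSum _ fun i _ => hI i]
  refine Finset.sum_congr rfl fun i _ => ?_
  have hind : IndepFun ({ω | idx ω = i}.indicator (1 : Ω → ℝ)) (G i) P := by
    rw [IndepFun_iff_Indep]
    refine indep_of_indep_of_le_left (indep_of_indep_of_le_right hindep.symm ?_) ?_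
    · exact (hG i).comap_le
    · have e : {ω | idx ω = i}.indicator (1 : Ω → ℝ) =
          (fun j => if j = i then (1 : ℝ) else 0) ∘ idx := by
        ext ω
        simp [Set.indicator_apply]
      rw [e, ← MeasurableSpace.comap_comp]
      exact MeasurableSpace.comap_mono le_top
  have := hind.integral_mul_eq_mul_integral
    ((measurable_one.indicator (hset i)).aestronglyMeasurable)
    ((hG i).mono hm le_rfl).aestronglyMeasurable
  have e : {ω | idx ω = i}.indicator (G i) = {ω | idx ω = i}.indicator (1 : Ω → ℝ) * G i := by
    ext ω
    by_cases h : idx ω = i <;> simp [h]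
  rw [e, this, integral_indicator_one (hset i), measureReal_def, hlaw, ENNReal.toReal_ofReal (hp i)]

end Probability

/-! ### Expected descent along a run -/

section Runs

theorem integral_le_sqrt_integral_sq {Ω : Type*} {mΩ : MeasurableSpace Ω} {P : Measure Ω}
    [IsProbabilityMeasure P] {X : Ω → ℝ} (hX : MemLp X 2 P) :
    ∫ ω, X ω ∂P ≤ √(∫ ω, X ω ^ 2 ∂P) := by
  refine Real.le_sqrt_of_sq_le ?_
  have h1 := variance_eq_sub hX
  have h2 := variance_nonneg X P
  simp only [Pi.pow_apply] at h1
  linarith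

variable {m n r : ℕ} {f : EuclideanSpace ℝ (Fin n) → ℝ} {α : ℝ} {A : Matrix (Fin m) (Fin n) ℝ}
  {I : Fin r → Finset (Fin m)} {IQ : Set (Fin r)} {p : Fin r → ℝ}
  {xhat x₀ x₀s : EuclideanSpace ℝ (Fin n)} {Ω : Type*} {mΩ : MeasurableSpace Ω} {P : Measure Ω}
  {ℱ : Filtration ℕ mΩ} {idx : ℕ → Ω → Fin r} {x xs : ℕ → Ω → EuclideanSpace ℝ (Fin n)}

/-- Valid for every `ω`: this gives integrability and keeps the iterates where one error bound
applies. -/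
theorem IsRandomizedRun.invariants (hα : 0 < α) (hf : StrongConvexOn Set.univ α f)
    (h₀ : x₀s ∈ subdiff f x₀) (h₀A : x₀s ∈ (LinearMap.ker A.toEuclideanLin)ᗮ)
    (h : IsRandomizedRun (BlockStep f A (A.toEuclideanLin xhat) I IQ) p x₀ x₀s P ℱ idx x xs)
    (k : ℕ) (ω : Ω) :
    xs k ω ∈ subdiff f (x k ω) ∧ xs k ω ∈ (LinearMap.ker A.toEuclideanLin)ᗮ ∧
      bregmanDist f (xs k ω) (x k ω) xhat ≤ bregmanDist f x₀s x₀ xhat := by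
  obtain ⟨N, hN, hAN⟩ := exists_norm_map_le A.toEuclideanLin
  induction k with
  | zero =>
    rw [h.init_x, h.init_xs]
    exact ⟨h₀, h₀A, le_rfl⟩
  | succ k ih =>
    obtain ⟨h1, h2, h3⟩ := blockStep_descent A hα hf hN hAN ih.1 ih.2.1 (h.update k ω)
    have : 0 ≤ α / (2 * N) *
      ‖(rowBlock A (I (idx k ω))).toEuclideanLin (x k ω - xhat)‖ ^ 2 := by positivity
    exact ⟨h1, h2, by linarith [ih.2.2]⟩

theorem IsRandomizedRun.measurable_bregmanDist (hf : Continuous f)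
    {step : Fin r → EuclideanSpace ℝ (Fin n) → EuclideanSpace ℝ (Fin n) →
      EuclideanSpace ℝ (Fin n) → EuclideanSpace ℝ (Fin n) → Prop}
    (h : IsRandomizedRun step p x₀ x₀s P ℱ idx x xs) (k : ℕ) :
    Measurable fun ω => bregmanDist f (xs k ω) (x k ω) xhat := by
  have h1 : Measurable (x k) := (h.measurable_x k).mono (ℱ.le k) le_rfl
  have h2 : Measurable (xs k) := (h.measurable_xs k).mono (ℱ.le k) le_rfl
  have h3 := hf.measurable
  unfold bregmanDist
  fun_prop

theorem IsRandomizedRun.integrable_bregmanDist [IsProbabilityMeasure P] (hα : 0 < α)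
    (hf : StrongConvexOn Set.univ α f)
    (h₀ : x₀s ∈ subdiff f x₀) (h₀A : x₀s ∈ (LinearMap.ker A.toEuclideanLin)ᗮ)
    (h : IsRandomizedRun (BlockStep f A (A.toEuclideanLin xhat) I IQ) p x₀ x₀s P ℱ idx x xs)
    (k : ℕ) : Integrable (fun ω => bregmanDist f (xs k ω) (x k ω) xhat) P := by
  refine Integrable.of_bound (h.measurable_bregmanDist
    (continuous_of_strongConvexOn hα.le hf) k).aestronglyMeasurable
    (bregmanDist f x₀s x₀ xhat) (Eventually.of_forall fun ω => ?_)
  obtain ⟨h1, -, h2⟩ := h.invariants hα hf h₀ h₀A k ω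
  rwa [Real.norm_of_nonneg (bregmanDist_nonneg h1 xhat)]

theorem IsRandomizedRun.memLp_norm_sub [IsProbabilityMeasure P] (hα : 0 < α)
    (hf : StrongConvexOn Set.univ α f)
    (h₀ : x₀s ∈ subdiff f x₀) (h₀A : x₀s ∈ (LinearMap.ker A.toEuclideanLin)ᗮ)
    (h : IsRandomizedRun (BlockStep f A (A.toEuclideanLin xhat) I IQ) p x₀ x₀s P ℱ idx x xs)
    (k : ℕ) : MemLp (fun ω => ‖x k ω - xhat‖) 2 P := by
  have h1 : Measurable (x k) := (h.measurable_x k).mono (ℱ.le k) le_rfl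
  refine MemLp.of_bound (by fun_prop) √(2 / α * bregmanDist f x₀s x₀ xhat)
    (Eventually.of_forall fun ω => ?_)
  obtain ⟨h1, -, h2⟩ := h.invariants hα hf h₀ h₀A k ω
  rw [norm_norm]
  refine Real.le_sqrt_of_sq_le ?_
  have h3 := sq_norm_le_bregmanDist hf h1 xhat
  rw [div_mul_eq_mul_div, le_div_iff₀ hα, norm_sub_rev]
  linarith

/-- One step of the method decreases the expected Bregman distance by a multiple of the expected
squared residual. -/
theorem IsRandomizedRun.integral_descent [IsProbabilityMeasure P] (hα : 0 < α)
    (hf : StrongConvexOn Set.univ α f)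
    (h₀ : x₀s ∈ subdiff f x₀) (h₀A : x₀s ∈ (LinearMap.ker A.toEuclideanLin)ᗮ)
    (hI : ∀ j, ∃ i, j ∈ I i) {δ : ℝ} (hδ : 0 < δ) (hp : ∀ i, δ ≤ p i) {N : ℝ} (hN : 0 < N)
    (hAN : ∀ h, ‖A.toEuclideanLin h‖ ^ 2 ≤ N * ‖h‖ ^ 2)
    (h : IsRandomizedRun (BlockStep f A (A.toEuclideanLin xhat) I IQ) p x₀ x₀s P ℱ idx x xs)
    (k : ℕ) :
    ∫ ω, bregmanDist f (xs (k + 1) ω) (x (k + 1) ω) xhat ∂P ≤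
      ∫ ω, bregmanDist f (xs k ω) (x k ω) xhat ∂P -
        α / (2 * N) * (δ * ∫ ω, ‖A.toEuclideanLin (x k ω - xhat)‖ ^ 2 ∂P) := by
  set G : Fin r → Ω → ℝ := fun i ω => ‖(rowBlock A (I i)).toEuclideanLin (x k ω - xhat)‖ ^ 2
  have hD := h.integrable_bregmanDist hα hf h₀ h₀A
  have hG i : Measurable[ℱ k] (G i) := by
    have h1 : Continuous fun v => ‖(rowBlock A (I i)).toEuclideanLin (v - xhat)‖ ^ 2 := by
      have := (rowBlock A (I i)).toEuclideanLin.continuous_of_finiteDimensional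
      fun_prop
    exact h1.measurable.comp (h.measurable_x k)
  have hsq := (h.memLp_norm_sub hα hf h₀ h₀A k).integrable_sq
  have hx : Measurable (x k) := (h.measurable_x k).mono (ℱ.le k) le_rfl
  have hAint : Integrable (fun ω => ‖A.toEuclideanLin (x k ω - xhat)‖ ^ 2) P := by
    have h1 := A.toEuclideanLin.continuous_of_finiteDimensional.measurable
    refine (hsq.const_mul N).mono' ?_ (Eventually.of_forall fun ω => ?_)
    · exact Measurable.aestronglyMeasurable (by fun_prop)
    · rw [Real.norm_of_nonneg (by positivity)]
      exact hAN _
  have hGint i : Integrable (G i) P := by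
    refine hAint.mono' ((hG i).mono (ℱ.le k) le_rfl).aestronglyMeasurable
      (Eventually.of_forall fun ω => ?_)
    rw [Real.norm_of_nonneg (by positivity)]
    exact sq_norm_rowBlock_le _ _ _
  obtain ⟨hcomp, hcomp_eq⟩ := integral_comp_index_of_indep (fun i => hδ.le.trans (hp i)) (ℱ.le k)
    ((h.measurable_idx k).mono (ℱ.le (k + 1)) le_rfl) (h.law_idx k) (h.indep_idx k) hG hGint
  -- Every block has probability at least `δ`, and the block residuals together dominate the full
  -- one.
  have hres : δ * ∫ ω, ‖A.toEuclideanLin (x k ω - xhat)‖ ^ 2 ∂P ≤ ∑ i, p i * ∫ ω, G i ω ∂P := by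
    calc δ * ∫ ω, ‖A.toEuclideanLin (x k ω - xhat)‖ ^ 2 ∂P ≤ δ * ∫ ω, ∑ i, G i ω ∂P := by
          gcongr δ * ?_
          exact integral_mono hAint (integrable_finsetSum _ fun i _ => hGint i)
            fun ω => sq_norm_le_sum_sq_norm_rowBlock A hI _
      _ = ∑ i, δ * ∫ ω, G i ω ∂P := by
          rw [integral_finsetSum _ fun i _ => hGint i, Finset.mul_sum]
      _ ≤ _ := Finset.sum_le_sum fun i _ => mul_le_mul_of_nonneg_right (hp i)
          (integral_nonneg fun ω => sq_nonneg _)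
  calc ∫ ω, bregmanDist f (xs (k + 1) ω) (x (k + 1) ω) xhat ∂P
      ≤ ∫ ω, (bregmanDist f (xs k ω) (x k ω) xhat - α / (2 * N) * G (idx k ω) ω) ∂P := by
        refine integral_mono (hD (k + 1)) ((hD k).sub (hcomp.const_mul _)) fun ω => ?_
        obtain ⟨h1, h2, -⟩ := h.invariants hα hf h₀ h₀A k ω
        exact (blockStep_descent A hα hf hN hAN h1 h2 (h.update k ω)).2.2
    _ = ∫ ω, bregmanDist f (xs k ω) (x k ω) xhat ∂P -
          α / (2 * N) * ∑ i, p i * ∫ ω, G i ω ∂P := by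
        rw [integral_sub (hD k) (hcomp.const_mul _), integral_const_mul, hcomp_eq]
    _ ≤ _ := by gcongr

end Runs

end BregmanSFP

/-! ### Linear convergence in expectation -/

theorem mainTheorem2 {m n r : ℕ}
    (f : EuclideanSpace ℝ (Fin n) → ℝ) (α : ℝ) (hα : 0 < α) (hf : StrongConvexOn Set.univ α f)
    (A : Matrix (Fin m) (Fin n) ℝ) (b : EuclideanSpace ℝ (Fin m))
    (xhat : EuclideanSpace ℝ (Fin n)) (hfeas : A.toEuclideanLin xhat = b)
    (hmin : IsMinOn f {x | A.toEuclideanLin x = b} xhat)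
    (hcalm : BregmanSFP.CalmAt (BregmanSFP.subdiff f) xhat)
    (hreg : BregmanSFP.LinearlyRegular
      ![BregmanSFP.subdiff f xhat, (LinearMap.range A.transpose.toEuclideanLin : Set _)])
    (I : Fin r → Finset (Fin m)) (hI : ∀ j, ∃ i, j ∈ I i) (IQ : Set (Fin r))
    (p : Fin r → ℝ) (hp : ∀ i, 0 < p i) (hp1 : ∑ i, p i = 1)
    (x₀ x₀s : EuclideanSpace ℝ (Fin n))
    (hx₀s : x₀s ∈ LinearMap.range A.transpose.toEuclideanLin)
    (hx₀ : x₀ = ∇ (BregmanSFP.conjugate f) x₀s) :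
    ∃ q c : ℝ, 0 < q ∧ q < 1 ∧ 0 < c ∧
      ∀ (Ω : Type*) (mΩ : MeasurableSpace Ω) (P : Measure Ω) (ℱ : Filtration ℕ mΩ)
        (idx : ℕ → Ω → Fin r) (x xs : ℕ → Ω → EuclideanSpace ℝ (Fin n)),
        IsProbabilityMeasure P →
        BregmanSFP.IsRandomizedRun (BregmanSFP.BlockStep f A b I IQ) p x₀ x₀s P ℱ idx x xs →
        (∀ k, Integrable (fun ω => BregmanSFP.bregmanDist f (xs k ω) (x k ω) xhat) P) ∧
        (∀ k, Integrable (fun ω => ‖x k ω - xhat‖) P) ∧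
        Tendsto (fun k => ∫ ω, ‖x k ω - xhat‖ ∂P) atTop (𝓝 0) ∧
        (∀ k, ∫ ω, BregmanSFP.bregmanDist f (xs (k + 1) ω) (x (k + 1) ω) xhat ∂P ≤
          q * ∫ ω, BregmanSFP.bregmanDist f (xs k ω) (x k ω) xhat ∂P) ∧
        (∀ k, ∫ ω, ‖x k ω - xhat‖ ∂P ≤ c * q ^ ((k : ℝ) / 2)) := by
  obtain rfl := hfeas
  have hr_nonempty : Nonempty (Fin r) := by
    by_contra hr
    rw [not_nonempty_iff] at hr
    simp at hp1
  obtain ⟨i₀, hi₀⟩ := Finite.exists_min p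
  rw [BregmanSFP.range_toEuclideanLin_transpose] at hx₀s hreg
  obtain ⟨ys, hys⟩ := hcalm.1
  have h₀ : x₀s ∈ BregmanSFP.subdiff f x₀ := by
    rw [hx₀]
    exact BregmanSFP.mem_subdiff_gradient_conjugate hα hf hys x₀s
  set D₀ := BregmanSFP.bregmanDist f x₀s x₀ xhat with hD₀
  have hD₀_nonneg : 0 ≤ D₀ := BregmanSFP.bregmanDist_nonneg h₀ xhat
  obtain ⟨N, hN, hAN⟩ := BregmanSFP.exists_norm_map_le A.toEuclideanLin
  obtain ⟨K, hK, herr⟩ :=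
    BregmanSFP.exists_bregmanDist_le_sq_norm_map hα hf hcalm A.toEuclideanLin hreg D₀
  have hpi := hp i₀
  have hκ : 0 < α / (2 * N) * (p i₀ * K⁻¹) := by positivity
  -- The `1/2` keeps `q` positive; enlarging `q` is harmless as the distances are nonnegative.
  set q : ℝ := max (1 - α / (2 * N) * (p i₀ * K⁻¹)) (1 / 2)
  have hq0 : 0 < q := lt_max_of_lt_right (by norm_num)
  have hq1 : q < 1 := max_lt (by linarith) (by norm_num)
  -- The `+ 1` ensures `c > 0` even when `D₀ = 0`.
  refine ⟨q, √(2 / α * D₀) + 1, hq0, hq1, by positivity, ?_⟩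
  intro Ω mΩ P ℱ idx x xs hP h
  have hD := h.integrable_bregmanDist hα hf h₀ hx₀s
  have hL := h.memLp_norm_sub hα hf h₀ hx₀s
  have hcontr : ∀ k, ∫ ω, BregmanSFP.bregmanDist f (xs (k + 1) ω) (x (k + 1) ω) xhat ∂P ≤
      q * ∫ ω, BregmanSFP.bregmanDist f (xs k ω) (x k ω) xhat ∂P := by
    intro k
    have h1 := h.integral_descent hα hf h₀ hx₀s hI hpi hi₀ hN hAN k
    have h2 : K⁻¹ * ∫ ω, BregmanSFP.bregmanDist f (xs k ω) (x k ω) xhat ∂P ≤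
        ∫ ω, ‖A.toEuclideanLin (x k ω - xhat)‖ ^ 2 ∂P := by
      rw [← integral_const_mul]
      refine integral_mono_of_nonneg (Eventually.of_forall fun ω => ?_) ?_
        (Eventually.of_forall fun ω => ?_)
      · have := BregmanSFP.bregmanDist_nonneg (h.invariants hα hf h₀ hx₀s k ω).1 xhat
        exact mul_nonneg (by positivity) this
      · refine ((hL k).integrable_sq.const_mul N).mono' ?_ (Eventually.of_forall fun ω => ?_)
        · have hx : Measurable (x k) := (h.measurable_x k).mono (ℱ.le k) le_rfl
          have := A.toEuclideanLin.continuous_of_finiteDimensional.measurable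
          exact Measurable.aestronglyMeasurable (by fun_prop)
        · rw [Real.norm_of_nonneg (by positivity)]
          exact hAN _
      · obtain ⟨g1, g2, g3⟩ := h.invariants hα hf h₀ hx₀s k ω
        exact (inv_mul_le_iff₀ hK).2 (herr _ _ g1 g2 g3)
    have h3 : 0 ≤ ∫ ω, BregmanSFP.bregmanDist f (xs k ω) (x k ω) xhat ∂P :=
      integral_nonneg fun ω =>
        BregmanSFP.bregmanDist_nonneg (h.invariants hα hf h₀ hx₀s k ω).1 xhat
    have h4 : α / (2 * N) *
        (p i₀ * (K⁻¹ * ∫ ω, BregmanSFP.bregmanDist f (xs k ω) (x k ω) xhat ∂P)) ≤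
        α / (2 * N) * (p i₀ * ∫ ω, ‖A.toEuclideanLin (x k ω - xhat)‖ ^ 2 ∂P) := by gcongr
    refine le_trans ?_ (mul_le_mul_of_nonneg_right (le_max_left _ _) h3)
    linarith
  have hpow : ∀ k, ∫ ω, BregmanSFP.bregmanDist f (xs k ω) (x k ω) xhat ∂P ≤ D₀ * q ^ k := by
    intro k
    induction k with
    | zero => simp [h.init_x, h.init_xs, hD₀]
    | succ k ih =>
      refine (hcontr k).trans ?_
      rw [pow_succ, ← mul_assoc, mul_comm]
      gcongr
  have hrate : ∀ k, ∫ ω, ‖x k ω - xhat‖ ∂P ≤ (√(2 / α * D₀) + 1) * q ^ ((k : ℝ) / 2) := by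
    intro k
    have h1 : ∫ ω, ‖x k ω - xhat‖ ^ 2 ∂P ≤
        2 / α * ∫ ω, BregmanSFP.bregmanDist f (xs k ω) (x k ω) xhat ∂P := by
      rw [← integral_const_mul]
      refine integral_mono (hL k).integrable_sq ((hD k).const_mul _) fun ω => ?_
      have := BregmanSFP.sq_norm_le_bregmanDist hf (h.invariants hα hf h₀ hx₀s k ω).1 xhat
      simp only
      rw [div_mul_eq_mul_div, le_div_iff₀ hα, norm_sub_rev]
      linarith
    have h2 : √(q ^ k) = q ^ ((k : ℝ) / 2) := by
      rw [Real.sqrt_eq_rpow, ← Real.rpow_natCast, ← Real.rpow_mul hq0.le]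
      ring_nf
    calc ∫ ω, ‖x k ω - xhat‖ ∂P ≤ √(∫ ω, ‖x k ω - xhat‖ ^ 2 ∂P) :=
          BregmanSFP.integral_le_sqrt_integral_sq (hL k)
      _ ≤ √(2 / α * D₀ * q ^ k) := by
          refine Real.sqrt_le_sqrt (h1.trans ?_)
          rw [mul_assoc]
          gcongr
          exact hpow k
      _ = √(2 / α * D₀) * q ^ ((k : ℝ) / 2) := by rw [Real.sqrt_mul (by positivity), h2]
      _ ≤ _ := by gcongr; linarith
  refine ⟨hD, fun k => (hL k).integrable one_le_two, ?_, hcontr, hrate⟩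
  refine squeeze_zero (fun k => integral_nonneg fun ω => norm_nonneg _) hrate ?_
  rw [← mul_zero (√(2 / α * D₀) + 1)]
  refine Tendsto.const_mul _ ?_
  have : Tendsto (fun y : ℝ => q ^ y) atTop (𝓝 0) :=
    tendsto_rpow_atTop_of_base_lt_one q (by linarith) hq1
  exact this.comp (tendsto_natCast_atTop_atTop.atTop_div_const two_pos)
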